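/- **Conventions.** A signature $\sigma$ is a finite set of relation symbols $R$, each with an arity $\mathrm{ar}(R)\ge 1$. A $\sigma$-structure $\mathbf A$ is a finite set $A$ with a (possibly empty) relation $R^{\mathbf A}\subseteq A^{\mathrm{ar}(R)}$ for each $R\in\sigma$; the set of its constraints is $\mathcal C_{\mathbf A}=\{R(\mathbf a) : R\in\sigma,\ \mathbf a\in R^{\mathbf A}\}$ (formal expressions), and $\{\mathbf a\}$ is the set of entries of a tuple $\mathbf a$. Write $\mathbf A\to\mathbf B$ if there is a homomorphism from $\mathbf A$ to $\mathbf B$. **The relation $\equiv_1$.** Let $v\in A\cup\mathcal C_{\mathbf A}$ (disjoint union). The $0$-th iterated degree $\delta_0^{\mathbf A}(v)$ is one of two fixed symbols that tells elements from constraints. An element $a$ and a constraint $R(\mathbf a)$ are adjacent if $a\in\{\mathbf a\}$, and this edge has the label $(S,R)$ with $S=\{i : a_i=a\}$. For $j\ge 1$, $\delta_j^{\mathbf A}(v)$ is the multiset of the pairs $(\ell,\delta_{j-1}^{\mathbf A}(w))$ where $w$ ranges over the neighbours of $v$ and $\ell$ is the label of the edge $\{v,w\}$. Put $\delta^{\mathbf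 A}(v)=(\delta_j^{\mathbf A}(v))_{j\ge0}$. Then $\mathbf A\equiv_1\mathbf B$ means that the multisets $\{\!\{\delta^{\mathbf A}(v): v\in A\cup\mathcal C_{\mathbf A}\}\!\}$ and $\{\!\{\delta^{\mathbf B}(v): v\in B\cup\mathcal C_{\mathbf B}\}\!\}$ are equal. **The system $\mathrm{SA}^k(\mathbf X,\mathbf A)$.** Its variables, which take values in $[0,1]$, are $p_V(f)$ for $V\subseteq X$ with $1\le|V|\le k$ and $f:V\to A$, and $p_{R(\mathbf x)}(f)$ for $R(\mathbf x)\in\mathcal C_{\mathbf X}$ and $f:\{\mathbf x\}\to A$. Its conditions are 1. $\sum_{f:V\to A}p_V(f)=1$ for all $V\subseteq X$ with $1\le|V|\le k$; 2. $p_U(f)=\sum_{g:V\to A,\ g|_U=f}p_V(g)$ for all $\emptyset\ne U\subseteq V\subseteq X$ with $|V|\le k$ and all $f:U\to A$; 3. $p_U(f)=\sum_{g:\{\mathbf x\}\to A,\ g|_U=f}p_{R(\mathbf x)}(g)$ for all $R(\mathbf x)\in\mathcal C_{\mathbf X}$, all $\emptyset\ne U\subseteq\{\mathbf x\}$ with $|U|\le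 k$ and all $f:U\to A$; 4. $p_{R(\mathbf x)}(f)=0$ for all $R(\mathbf x)\in\mathcal C_{\mathbf X}$ and all $f:\{\mathbf x\}\to A$ with $f(\mathbf x)\notin R^{\mathbf A}$. It is feasible if it has a rational solution. **The structure $\mathbf A^{*_k}$.** Its universe is the disjoint union $A^1\cup\dots\cup A^k\cup\mathcal C_{\mathbf A}$. Write $\pi_{\mathbf i}\mathbf a=(a_{i_1},\dots,a_{i_n})$ for $\mathbf i=(i_1,\dots,i_n)$. The relations of $\mathbf A^{*_k}$ are the unary and binary relations - $T_{j,S}=\{\mathbf a\in A^j : a_i=a_{i'}\ \forall i,i'\in S\}$ for $1\le j\le k$, $S\subseteq[j]$; - $T_{j,\mathbf i}=\{(\mathbf a,\pi_{\mathbf i}\mathbf a):\mathbf a\in A^j\}$ for $1\le j,j'\le k$, $\mathbf i\in[j]^{j'}$; - $R_S=\{R(\mathbf a):\mathbf a\in R^{\mathbf A},\ a_i=a_{i'}\ \forall i,i'\in S\}$ for $R\in\sigma$, $S\subseteq[\mathrm{ar}(R)]$; - $R_{\mathbf i}=\{(R(\mathbf a),\pi_{\mathbf i}\mathbf a):\mathbf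 a\in R^{\mathbf A}\}$ for $R\in\sigma$, $1\le j\le k$, $\mathbf i\in[\mathrm{ar}(R)]^{j}$. The symbols $T_{j,S},T_{j,\mathbf i},R_S,R_{\mathbf i}$ form the signature $\sigma^*_k$ of $\mathbf A^{*_k}$. **Theorem 7.5.** Let $k\ge1$ and let $\mathbf X$, $\mathbf A$ be $\sigma$-structures. The following are equivalent: 1. $\mathrm{SA}^k(\mathbf X,\mathbf A)$ is feasible; 2. there are $n\ge0$ and $\sigma^*_k$-structures $\mathbf Y_0,\dots,\mathbf Y_n$ with $\mathbf Y_0=\mathbf X^{*_k}$ and $\mathbf Y_n=\mathbf A^{*_k}$ such that, for all $i=0,\dots,n-1$, $\mathbf Y_i\to\mathbf Y_{i+1}$ or $\mathbf Y_i\equiv_1\mathbf Y_{i+1}$; 3. there are $\sigma^*_k$-structures $\mathbf Y_1,\mathbf Y_2$ with $\mathbf X^{*_k}\to\mathbf Y_1$, $\mathbf Y_1\equiv_1\mathbf Y_2$ and $\mathbf Y_2\to\mathbf A^{*_k}$. -/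

import Mathlib

open scoped FirstOrder

universe u v w

namespace SheraliAdams

/-! ### Finite relational structures and homomorphisms -/

/-- A finite structure over `L`: a finite universe with an interpretation of the symbols of `L`. -/
structure FinStruct (L : FirstOrder.Language.{v, w}) where
  carrier : Type u
  [str : L.Structure carrier]
  [finite : Finite carrier]

instance (L : FirstOrder.Language.{v, w}) : CoeSort (FinStruct.{u} L) (Type u) := ⟨FinStruct.carrier⟩

attribute [instance] FinStruct.str FinStruct.finite

/-- `X → Y`: there is a homomorphism from `X` to `Y`. -/
def Homomorphic {L : FirstOrder.Language.{v, w}} (X Y : FinStruct.{u} L) : Prop :=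
  Nonempty (X →[L] Y)

/-- The set of constraints `R(x)` of `X`, where `R` is a relation symbol and `x` is a tuple in the
relation that interprets `R`. -/
structure Constraint {L : FirstOrder.Language.{v, w}} (X : FinStruct.{u} L) where
  arity : ℕ
  symbol : L.Relations arity
  args : Fin arity → X
  mem : FirstOrder.Language.Structure.RelMap symbol args

namespace Constraint

/-- The set `{x}` of entries of the tuple of a constraint `R(x)`. -/
def scope {L : FirstOrder.Language.{v, w}} {X : FinStruct.{u} L} (c : Constraint X) : Set X :=
  Set.range c.args

instance {L : FirstOrder.Language.{v, w}} [Finite (Σ n, L.Relations n)] (X : FinStruct.{u} L) :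
    Finite (Constraint X) := by
  let f : Constraint X → Σ R : (Σ n, L.Relations n), (Fin R.1 → X) :=
    fun c => ⟨⟨c.arity, c.symbol⟩, c.args⟩
  refine Finite.of_injective f ?_
  rintro ⟨n, R, a, h⟩ ⟨n', R', a', h'⟩ he
  simp only [f, Sigma.mk.injEq] at he
  obtain ⟨⟨rfl, hR⟩, ha⟩ := he
  obtain rfl := eq_of_heq hR
  obtain rfl := eq_of_heq ha
  rfl

end Constraint

/-! ### Iterated degrees and the relation `≡₁` -/

/-- Labels `(S, R)` of the edges of factor graphs: a relation symbol `R` together with a set `S` of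
positions of `R`. -/
abbrev Label (L : FirstOrder.Language.{v, w}) : Type w :=
  Σ n, L.Relations n × Set (Fin n)

/-- The label of the pair of an element `a` and a constraint `R(x)`: the symbol `R` together with
the set of positions at which `a` occurs in `x`. -/
def edgeLabel {L : FirstOrder.Language.{v, w}} {Y : FinStruct.{u} L} (a : Y) (c : Constraint Y) : Label L :=
  ⟨c.arity, c.symbol, {i | c.args i = a}⟩

/-- The values that a `j`-th iterated degree can take: two symbols for `j = 0`, and multisets of
pairs of a label and a `(j - 1)`-st iterated degree for `j ≥ 1`. -/
def IterDeg (L : FirstOrder.Language.{v, w}) : ℕ → Type w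
  | 0 => ULift.{w} Bool
  | j + 1 => Multiset (Label L × IterDeg L j)

section

attribute [local instance] Fintype.ofFinite

open scoped Classical in
/-- The `j`-th iterated degree of a vertex of the factor graph of `Y`. The vertices are the elements
and the constraints of `Y`, and an element is adjacent to the constraints in which it occurs. -/
noncomputable def iterDeg {L : FirstOrder.Language.{v, w}} [Finite (Σ n, L.Relations n)]
    (Y : FinStruct.{u} L) : (j : ℕ) → Y ⊕ Constraint Y → IterDeg L j
  | 0, .inl _ => ULift.up false
  | 0, .inr _ => ULift.up true
  | j + 1, .inl a =>
      (Finset.univ.filter fun c : Constraint Y => a ∈ c.scope).val.map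
        fun c => (edgeLabel a c, iterDeg Y j (.inr c))
  | j + 1, .inr c =>
      (Finset.univ.filter fun a : Y => a ∈ c.scope).val.map
        fun a => (edgeLabel a c, iterDeg Y j (.inl a))

/-- The iterated degree sequence of `Y`: the multiset, over all elements and constraints `v` of `Y`,
of the sequences of all iterated degrees of `v`. -/
noncomputable def iterDegSeq {L : FirstOrder.Language.{v, w}} [Finite (Σ n, L.Relations n)]
    (Y : FinStruct.{u} L) : Multiset ((j : ℕ) → IterDeg L j) :=
  (Finset.univ : Finset (Y ⊕ Constraint Y)).val.map fun v j => iterDeg Y j v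

/-- `Y ≡₁ Z`: the structures have the same iterated degree sequence. -/
def EquivOne {L : FirstOrder.Language.{v, w}} [Finite (Σ n, L.Relations n)] (Y Z : FinStruct.{u} L) : Prop :=
  iterDegSeq Y = iterDegSeq Z

/-! ### The system of linear inequalities `SAᵏ(X, A)` -/

open scoped Classical in
/-- `p` and `q` form a rational solution of the system `SAᵏ(X, A)`. The variables of the system are
`p V f` for `V ⊆ X` with `1 ≤ |V| ≤ k` and `f : V → A`, and `q c f` for a constraint `c` of `X` and a
map `f` from the set of entries of `c` to `A` (the values `p V f` for other sets `V` play no role). -/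
structure IsSASolution {L : FirstOrder.Language.{v, w}} (k : ℕ) (X A : FinStruct.{u} L)
    (p : (V : Set X) → (V → A) → ℚ) (q : (c : Constraint X) → (c.scope → A) → ℚ) : Prop where
  p_mem_Icc : ∀ V : Set X, V.Nonempty → V.ncard ≤ k → ∀ f : V → A, p V f ∈ Set.Icc (0 : ℚ) 1
  q_mem_Icc : ∀ (c : Constraint X) (f : c.scope → A), q c f ∈ Set.Icc (0 : ℚ) 1
  sum_eq_one : ∀ V : Set X, V.Nonempty → V.ncard ≤ k → ∑ f : V → A, p V f = 1
  marginal : ∀ (U V : Set X) (hUV : U ⊆ V), U.Nonempty → V.ncard ≤ k → ∀ f : U → A,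
    p U f = ∑ g : V → A with g ∘ Set.inclusion hUV = f, p V g
  constraint_marginal : ∀ (c : Constraint X) (U : Set X) (hU : U ⊆ c.scope),
    U.Nonempty → U.ncard ≤ k → ∀ f : U → A,
    p U f = ∑ g : c.scope → A with g ∘ Set.inclusion hU = f, q c g
  constraint_zero : ∀ (c : Constraint X) (f : c.scope → A),
    ¬ FirstOrder.Language.Structure.RelMap c.symbol (fun i => f ⟨c.args i, Set.mem_range_self i⟩) → q c f = 0

/-- `SAᵏ(X, A)` is feasible: it has a rational solution. -/
def SAFeasible {L : FirstOrder.Language.{v, w}} (k : ℕ) (X A : FinStruct.{u} L) : Prop :=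
  ∃ (p : (V : Set X) → (V → A) → ℚ) (q : (c : Constraint X) → (c.scope → A) → ℚ),
    IsSASolution k X A p q

end

/-! ### The operator `*ₖ`

An index `j : Fin k` stands for the number `j + 1` in `{1, …, k}`. -/

/-- The relation symbols of the signature of `X^{*ₖ}`: `T_{j,S}` and `R_S` are unary, and
`T_{j,i}` and `R_i` are binary. -/
inductive StarRel (L : FirstOrder.Language.{v, w}) (k : ℕ) : ℕ → Type w
  | tupleEq (j : Fin k) (S : Set (Fin (j + 1))) : StarRel L k 1
  | constraintEq {n : ℕ} (R : L.Relations n) (S : Set (Fin n)) : StarRel L k 1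
  | tupleProj (j j' : Fin k) (i : Fin (j' + 1) → Fin (j + 1)) : StarRel L k 2
  | constraintProj {n : ℕ} (R : L.Relations n) (j : Fin k) (i : Fin (j + 1) → Fin n) :
      StarRel L k 2

/-- The signature of `X^{*ₖ}`. -/
def starLang (L : FirstOrder.Language.{v, w}) (k : ℕ) : FirstOrder.Language.{0, w} :=
  ⟨fun _ => Empty, StarRel L k⟩

instance (L : FirstOrder.Language.{v, w}) (k : ℕ) : (starLang L k).IsRelational :=
  fun _ => inferInstanceAs (IsEmpty Empty)

instance (L : FirstOrder.Language.{v, w}) (k : ℕ) [Finite (Σ n, L.Relations n)] :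
    Finite (Σ n, (starLang L k).Relations n) := by
  let f : (Σ j : Fin k, Set (Fin (j + 1))) ⊕ (Σ R : (Σ n, L.Relations n), Set (Fin R.1)) ⊕
      (Σ j : Fin k, Σ j' : Fin k, (Fin (j' + 1) → Fin (j + 1))) ⊕
      (Σ R : (Σ n, L.Relations n), Σ j : Fin k, (Fin (j + 1) → Fin R.1)) →
      Σ n, StarRel L k n
    | .inl ⟨j, S⟩ => ⟨1, .tupleEq j S⟩
    | .inr (.inl ⟨⟨_, R⟩, S⟩) => ⟨1, .constraintEq R S⟩
    | .inr (.inr (.inl ⟨j, j', i⟩)) => ⟨2, .tupleProj j j' i⟩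
    | .inr (.inr (.inr ⟨⟨_, R⟩, j, i⟩)) => ⟨2, .constraintProj R j i⟩
  refine Finite.of_surjective (β := Σ n, StarRel L k n) f ?_
  rintro ⟨_, s⟩
  cases s with
  | tupleEq j S => exact ⟨.inl ⟨j, S⟩, rfl⟩
  | constraintEq R S => exact ⟨.inr (.inl ⟨⟨_, R⟩, S⟩), rfl⟩
  | tupleProj j j' i => exact ⟨.inr (.inr (.inl ⟨j, j', i⟩)), rfl⟩
  | constraintProj R j i => exact ⟨.inr (.inr (.inr ⟨⟨_, R⟩, j, i⟩)), rfl⟩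

/-- The universe of `X^{*ₖ}`: the tuples over `X` of length `1, …, k`, and the constraints of `X`. -/
inductive StarCarrier {L : FirstOrder.Language.{v, w}} (k : ℕ) (X : FinStruct.{u} L) : Type (max u w)
  | tuple (j : Fin k) (a : Fin (j + 1) → X)
  | constraint (c : Constraint X)

instance {L : FirstOrder.Language.{v, w}} [Finite (Σ n, L.Relations n)] (k : ℕ) (X : FinStruct.{u} L) :
    Finite (StarCarrier k X) := by
  let f : (Σ j : Fin k, (Fin (j + 1) → X)) ⊕ Constraint X → StarCarrier k X
    | .inl ⟨j, a⟩ => .tuple j a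
    | .inr c => .constraint c
  refine Finite.of_surjective f ?_
  rintro (⟨j, a⟩ | c)
  · exact ⟨.inl ⟨j, a⟩, rfl⟩
  · exact ⟨.inr c, rfl⟩

/-- The interpretation of the relation symbols in `X^{*ₖ}`. -/
def starRelMap {L : FirstOrder.Language.{v, w}} (k : ℕ) (X : FinStruct.{u} L) :
    {n : ℕ} → StarRel L k n → (Fin n → StarCarrier k X) → Prop
  | _, .tupleEq j S, z =>
      ∃ a : Fin (j + 1) → X, (∀ i ∈ S, ∀ i' ∈ S, a i = a i') ∧ z 0 = .tuple j a
  | _, .constraintEq (n := n) R S, z =>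
      ∃ (a : Fin n → X) (ha : FirstOrder.Language.Structure.RelMap R a),
        (∀ i ∈ S, ∀ i' ∈ S, a i = a i') ∧ z 0 = .constraint ⟨n, R, a, ha⟩
  | _, .tupleProj j j' i, z =>
      ∃ a : Fin (j + 1) → X, z 0 = .tuple j a ∧ z 1 = .tuple j' (a ∘ i)
  | _, .constraintProj (n := n) R j i, z =>
      ∃ (a : Fin n → X) (ha : FirstOrder.Language.Structure.RelMap R a),
        z 0 = .constraint ⟨n, R, a, ha⟩ ∧ z 1 = .tuple j (a ∘ i)

instance {L : FirstOrder.Language.{v, w}} (k : ℕ) (X : FinStruct.{u} L) :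
    (starLang L k).Structure (StarCarrier k X) where
  funMap f := f.elim
  RelMap r := starRelMap k X r

/-- The structure `X^{*ₖ}`. -/
def star {L : FirstOrder.Language.{v, w}} [Finite (Σ n, L.Relations n)] (k : ℕ) (X : FinStruct.{u} L) :
    FinStruct.{max u w} (starLang L k) where
  carrier := StarCarrier k X

end SheraliAdams

namespace SheraliAdams

/-! ### Iterated degrees of elements and constraints -/

section Degrees

attribute [local instance] Fintype.ofFinite

open FirstOrder.Language.Structure

variable {L : FirstOrder.Language.{v, w}} [Finite (Σ n, L.Relations n)]

/-! Write X*, A* for the two starred structures. The notion that links the conditions is a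
fractional homomorphism (`IsFracHom`): each element is sent to a distribution on elements, each
constraint to a distribution on constraint tuples, with matching marginals.

From a chain to a solution: the identity gives a fractional homomorphism from A* to itself. It is
pulled back along the chain, through a homomorphism by composition (`FracHomomorphic.comp_hom`) and
through `≡₁` by averaging over all vertices of equal iterated degree
(`FracHomomorphic.comp_equivOne`). The result goes from X* to A*. The unary relations force each
value of positive weight at a tuple or constraint to be its image under a map on its entries, so the
weights become weights of maps. The binary relations turn into the marginal conditions of the linear
system (`feasible_of_fracHomomorphic`).

From a solution to a chain of length three: clearing denominators replaces every distribution by a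
list of N maps. The marginal conditions say that the list of a constraint or tuple, restricted to a
smaller tuple, is a permutation of the list of that tuple. Take N copies of X* and reconnect their
constraints along these permutations. Reconnecting does not change iterated degrees
(`equivOne_cover`). X* maps to the untwisted cover, and the twisted one maps to A* by evaluating the
listed maps (`exists_equivOne_of_feasible`). -/

theorem Constraint.nonempty_fin_arity {L : FirstOrder.Language.{v, w}} [IsEmpty (L.Relations 0)]
    {Y : FinStruct.{u} L} (c : Constraint Y) : Nonempty (Fin c.arity) := by
  obtain ⟨_ | n, R, x, h⟩ := c
  · exact (IsEmpty.false R).elim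
  · exact ⟨(0 : Fin (n + 1))⟩

/-- A bijection of vertices that preserves iterated degrees witnesses `≡₁`. -/
theorem equivOne_of_equiv {Y Z : FinStruct.{u} L} (e : Y ⊕ Constraint Y ≃ Z ⊕ Constraint Z)
    (h : ∀ v j, iterDeg Z j (e v) = iterDeg Y j v) : EquivOne Y Z := by
  unfold EquivOne iterDegSeq
  have h1 : (Finset.univ : Finset (Z ⊕ Constraint Z)) = Finset.univ.map e.toEmbedding := by simp
  rw [h1, Finset.map_val, Multiset.map_map]
  refine Multiset.map_congr rfl fun v _ => funext fun j => (h v j).symm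

theorem EquivOne.exists_vertex {Y Z : FinStruct.{u} L} (h : EquivOne Y Z) (v : Y ⊕ Constraint Y) :
    ∃ v' : Z ⊕ Constraint Z, ∀ j, iterDeg Z j v' = iterDeg Y j v := by
  have h1 : (fun j => iterDeg Y j v) ∈ iterDegSeq Y :=
    Multiset.mem_map.2 ⟨v, Finset.mem_univ v, rfl⟩
  rw [h] at h1
  obtain ⟨v', -, h2⟩ := Multiset.mem_map.1 h1
  exact ⟨v', fun j => congrFun h2 j⟩

theorem EquivOne.exists_elem {Y Z : FinStruct.{u} L} (h : EquivOne Y Z) (y : Y) :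
    ∃ z : Z, ∀ j, iterDeg Z j (.inl z) = iterDeg Y j (.inl y) := by
  obtain ⟨z | c, hz⟩ := h.exists_vertex (.inl y)
  · exact ⟨z, hz⟩
  · exact Bool.noConfusion (congrArg ULift.down (hz 0) : true = false)

theorem EquivOne.exists_constraint {Y Z : FinStruct.{u} L} (h : EquivOne Y Z) (c : Constraint Y) :
    ∃ d : Constraint Z, ∀ j, iterDeg Z j (.inr d) = iterDeg Y j (.inr c) := by
  obtain ⟨z | d, hz⟩ := h.exists_vertex (.inr c)
  · exact Bool.noConfusion (congrArg ULift.down (hz 0) : false = true)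
  · exact ⟨d, hz⟩

theorem exists_edge_of_iterDeg_eq {Y Z : FinStruct.{u} L} {c : Constraint Y} {d : Constraint Z}
    {j : ℕ} (h : iterDeg Z (j + 1) (.inr d) = iterDeg Y (j + 1) (.inr c)) (i : Fin c.arity) :
    ∃ a : Z, edgeLabel a d = edgeLabel (c.args i) c ∧
      iterDeg Z j (.inl a) = iterDeg Y j (.inl (c.args i)) := by
  classical
  have h1 : Membership.mem (γ := Multiset (Label L × IterDeg L j)) (iterDeg Y (j + 1) (.inr c))
      (edgeLabel (c.args i) c, iterDeg Y j (.inl (c.args i))) := by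
    refine Multiset.mem_map.2 ⟨c.args i, ?_, rfl⟩
    simp [Constraint.scope]
  rw [← h] at h1
  obtain ⟨a, -, ha⟩ := Multiset.mem_map.1 h1
  exact ⟨a, congrArg Prod.fst ha, congrArg Prod.snd ha⟩

/-- Constraints with the same iterated degrees have the same symbol. -/
theorem exists_args_of_iterDeg_eq [IsEmpty (L.Relations 0)] {Y Z : FinStruct.{u} L} {n : ℕ}
    {R : L.Relations n} {x : Fin n → Y} (h : RelMap R x) {d : Constraint Z}
    (hd : iterDeg Z 1 (.inr d) = iterDeg Y 1 (.inr ⟨n, R, x, h⟩)) :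
    ∃ (x' : Fin n → Z) (h' : RelMap R x'), d = ⟨n, R, x', h'⟩ := by
  obtain ⟨i⟩ := Constraint.nonempty_fin_arity ⟨n, R, x, h⟩
  obtain ⟨a, ha, -⟩ := exists_edge_of_iterDeg_eq hd i
  obtain ⟨m, S, x', h'⟩ := d
  simp only [edgeLabel, Sigma.mk.injEq] at ha
  obtain ⟨rfl, ha⟩ := ha
  obtain rfl := congrArg Prod.fst (eq_of_heq ha)
  exact ⟨x', h', rfl⟩

/-- Constraints with the same iterated degrees have entries with the same iterated degrees, and the
same pattern of equal entries. -/
theorem args_of_iterDeg_eq {Y Z : FinStruct.{u} L} {n : ℕ}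
    {R : L.Relations n} {x : Fin n → Y} (h : RelMap R x) {x' : Fin n → Z} (h' : RelMap R x') {j : ℕ}
    (hd : iterDeg Z (j + 1) (.inr ⟨n, R, x', h'⟩) = iterDeg Y (j + 1) (.inr ⟨n, R, x, h⟩))
    (i : Fin n) :
    iterDeg Z j (.inl (x' i)) = iterDeg Y j (.inl (x i)) ∧ ∀ i', x' i' = x' i ↔ x i' = x i := by
  obtain ⟨a, ha, ha'⟩ := exists_edge_of_iterDeg_eq hd i
  simp only [edgeLabel, Sigma.mk.injEq, heq_eq_eq, Prod.mk.injEq, true_and] at ha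
  have h1 : ∀ i', x' i' = a ↔ x i' = x i := fun i' => Set.ext_iff.1 ha i'
  obtain rfl : x' i = a := (h1 i).2 rfl
  exact ⟨ha', h1⟩

section Stabilization

variable (L) in
/-- The map that recovers the `j`-th iterated degree from the `(j + 1)`-st one. -/
noncomputable def truncDeg : (j : ℕ) → IterDeg L (j + 1) → IterDeg L j
  | 0, m => by
      classical
      exact ULift.up (decide (∃ x : Label L × ULift.{w} Bool,
        Membership.mem (γ := Multiset (Label L × ULift.{w} Bool)) m x ∧ x.2.down = false))
  | j + 1, m =>
      (m : Multiset (Label L × IterDeg L (j + 1))).map fun x => (x.1, truncDeg j x.2)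

/-- Only level 0 needs care: positive arity gives every constraint a neighbouring element, whereas
an element has only constraints as neighbours or none. A nullary constraint would look like an
isolated element. -/
theorem truncDeg_iterDeg [IsEmpty (L.Relations 0)] (Y : FinStruct.{u} L) (j : ℕ)
    (v : Y ⊕ Constraint Y) : truncDeg L j (iterDeg Y (j + 1) v) = iterDeg Y j v := by
  induction j generalizing v with
  | zero =>
    rcases v with a | c
    · refine congrArg ULift.up (@decide_eq_false _ (_) ?_)
      rintro ⟨x, hx, hx'⟩
      obtain ⟨c, -, rfl⟩ := Multiset.mem_map.1 hx
      exact Bool.noConfusion (hx' : true = false)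
    · refine congrArg ULift.up (@decide_eq_true _ (_) ?_)
      obtain ⟨i⟩ := c.nonempty_fin_arity
      refine ⟨_, Multiset.mem_map.2 ⟨c.args i, ?_, rfl⟩, rfl⟩
      exact (@Finset.mem_filter _ _ (_) _ _).2 ⟨Finset.mem_univ _, Set.mem_range_self i⟩
  | succ j ih =>
    rcases v with a | c
    · refine (Multiset.map_map _ _ _).trans (Multiset.map_congr rfl fun c _ => ?_)
      exact congrArg _ (ih _)
    · refine (Multiset.map_map _ _ _).trans (Multiset.map_congr rfl fun c _ => ?_)
      exact congrArg _ (ih _)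

theorem iterDeg_eq_of_le [IsEmpty (L.Relations 0)] {Y Z : FinStruct.{u} L} {v : Y ⊕ Constraint Y}
    {v' : Z ⊕ Constraint Z} {i j : ℕ} (hij : i ≤ j) (h : iterDeg Z j v' = iterDeg Y j v) :
    iterDeg Z i v' = iterDeg Y i v := by
  induction hij with
  | refl => exact h
  | step _ ih => exact ih (by rw [← truncDeg_iterDeg, h, truncDeg_iterDeg])

/-- Iterated degrees stabilize. -/
theorem exists_iterDeg_stable [IsEmpty (L.Relations 0)] (Y Z : FinStruct.{u} L) :
    ∃ J, ∀ (v : Y ⊕ Constraint Y) (v' : Z ⊕ Constraint Z), iterDeg Z J v' = iterDeg Y J v →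
      ∀ j, iterDeg Z j v' = iterDeg Y j v := by
  -- For each of the finitely many pairs, choose a level at which its degrees differ, if there is
  -- one. Agreement passes to lower levels, so the maximum works for all pairs.
  have h : ∀ q : (Y ⊕ Constraint Y) × (Z ⊕ Constraint Z), ∃ J,
      iterDeg Z J q.2 = iterDeg Y J q.1 → ∀ j, iterDeg Z j q.2 = iterDeg Y j q.1 := by
    intro q
    by_cases hq : ∀ j, iterDeg Z j q.2 = iterDeg Y j q.1
    · exact ⟨0, fun _ => hq⟩
    · push Not at hq
      obtain ⟨J, hJ⟩ := hq
      exact ⟨J, fun h => absurd h hJ⟩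
  choose J hJ using h
  refine ⟨Finset.univ.sup J, fun v v' h => hJ (v, v') ?_⟩
  exact iterDeg_eq_of_le (Finset.le_sup (Finset.mem_univ (v, v'))) h

end Stabilization

open scoped Classical in
/-- The number of constraints with prescribed iterated degrees and prescribed symbol that contain an
element in a given position depends only on the iterated degrees of the element. -/
theorem card_constraints_eq [IsEmpty (L.Relations 0)] {Y Z : FinStruct.{u} L} {n : ℕ}
    {R : L.Relations n} (c : Constraint Y) (i : Fin n) {z z' : Z}
    (hz : ∀ j, iterDeg Z j (.inl z) = iterDeg Z j (.inl z')) :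
    (Finset.univ.filter fun x' : Fin n → Z => (∃ h' : RelMap R x',
      ∀ j, iterDeg Z j (.inr ⟨n, R, x', h'⟩) = iterDeg Y j (.inr c)) ∧ x' i = z).card =
    (Finset.univ.filter fun x' : Fin n → Z => (∃ h' : RelMap R x',
      ∀ j, iterDeg Z j (.inr ⟨n, R, x', h'⟩) = iterDeg Y j (.inr c)) ∧ x' i = z').card := by
  obtain ⟨J, hJ⟩ := exists_iterDeg_stable Y Z
  -- The cardinality is read off the degree of `z` at level `J + 1`: it counts the pairs satisfying
  -- `P`. By stability, agreement with `c` at level `J` means agreement at all levels.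
  let P : Label L × IterDeg L J → Prop := fun q =>
    (∃ S : Set (Fin n), i ∈ S ∧ q.1 = ⟨n, R, S⟩) ∧ q.2 = iterDeg Y J (.inr c)
  have key : ∀ z : Z, (Finset.univ.filter fun x' : Fin n → Z => (∃ h' : RelMap R x',
      ∀ j, iterDeg Z j (.inr ⟨n, R, x', h'⟩) = iterDeg Y j (.inr c)) ∧ x' i = z).card =
      Multiset.countP P (iterDeg Z (J + 1) (.inl z) : Multiset (Label L × IterDeg L J)) := by
    intro z
    rw [iterDeg, Multiset.countP_map, ← Finset.filter_val, Finset.card_val]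
    refine Finset.card_bij (fun x' hx' => ⟨n, R, x', (Finset.mem_filter.1 hx').2.1.1⟩) ?_ ?_ ?_
    · intro x' hx'
      obtain ⟨-, ⟨h', hd⟩, rfl⟩ := Finset.mem_filter.1 hx'
      simp only [Finset.mem_filter, Finset.mem_univ, true_and]
      exact ⟨⟨i, rfl⟩, ⟨{i' | x' i' = x' i}, rfl, rfl⟩, hd J⟩
    · intro x _ y _ hxy
      simpa using hxy
    · rintro ⟨m, R', x', h'⟩ hd
      obtain ⟨-, ⟨S, hS, hS'⟩, hJd⟩ := Finset.mem_filter.1 hd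
      simp only [edgeLabel, Sigma.mk.injEq] at hS'
      obtain ⟨rfl, hS'⟩ := hS'
      simp only [heq_eq_eq, Prod.mk.injEq] at hS'
      obtain ⟨rfl, rfl⟩ := hS'
      refine ⟨x', ?_, rfl⟩
      simp only [Finset.mem_filter, Finset.mem_univ, true_and]
      exact ⟨⟨h', hJ _ _ hJd⟩, hS⟩
  rw [key, key, hz]

end Degrees

/-! ### Covers of a structure twisted by permutations -/

section Cover

attribute [local instance] Fintype.ofFinite

open FirstOrder.Language.Structure

variable {L : FirstOrder.Language.{v, w}} [L.IsRelational]

/-- The `N`-fold cover of `X` given by permutations of the fibres: the constraints above `c` are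
those with entries `(c i, τ c (c i) s)` for a sheet `s`. -/
def cover (X : FinStruct.{u} L) (N : ℕ) (τ : Constraint X → X → Equiv.Perm (Fin N)) :
    FinStruct.{u} L where
  carrier := X × Fin N
  str :=
    { funMap := fun f => isEmptyElim f
      RelMap := fun {n} R z => ∃ (x : Fin n → X) (h : RelMap R x) (s : Fin N),
        z = fun i => (x i, τ ⟨n, R, x, h⟩ (x i) s) }

variable {X : FinStruct.{u} L} {N : ℕ} {τ : Constraint X → X → Equiv.Perm (Fin N)}

theorem relMap_cover {n : ℕ} {R : L.Relations n} {z : Fin n → cover X N τ} :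
    RelMap R z ↔ ∃ (x : Fin n → X) (h : RelMap R x) (s : Fin N),
      z = fun i => (x i, τ ⟨n, R, x, h⟩ (x i) s) := Iff.rfl

variable (τ) in
/-- The constraint above `c` in the sheet `s`. -/
def liftConstraint (q : Constraint X × Fin N) : Constraint (cover X N τ) :=
  ⟨q.1.arity, q.1.symbol, fun i => (q.1.args i, τ q.1 (q.1.args i) q.2), q.1.args, q.1.mem, q.2, rfl⟩

/-- The sheet can be recovered from any single entry, because each `τ c a` is a permutation;
positive arity supplies an entry. -/
theorem liftConstraint_bijective [IsEmpty (L.Relations 0)] :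
    Function.Bijective (liftConstraint τ) := by
  constructor
  · rintro ⟨⟨n, R, x, h⟩, s⟩ ⟨⟨n', R', x', h'⟩, s'⟩ he
    obtain ⟨hn, hR, hx⟩ := Constraint.mk.inj he
    obtain rfl : n = n' := hn
    obtain rfl := eq_of_heq hR
    have hx := fun i => congrFun (eq_of_heq hx) i
    obtain rfl : x = x' := funext fun i => congrArg Prod.fst (hx i)
    obtain ⟨i⟩ := Constraint.nonempty_fin_arity ⟨n, R, x, h⟩
    have := congrArg Prod.snd (hx i)
    simpa using this
  · rintro ⟨n, R, z, x, h, s, rfl⟩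
    exact ⟨(⟨n, R, x, h⟩, s), rfl⟩

theorem mem_scope_liftConstraint {q : Constraint X × Fin N} {a : X} {t : Fin N} :
    ((a, t) : X × Fin N) ∈ (liftConstraint τ q).scope ↔ a ∈ q.1.scope ∧ t = τ q.1 a q.2 := by
  constructor
  · rintro ⟨i, hi⟩
    obtain ⟨rfl, rfl⟩ := Prod.mk.inj hi
    exact ⟨⟨i, rfl⟩, rfl⟩
  · rintro ⟨⟨i, rfl⟩, rfl⟩
    exact ⟨i, rfl⟩

/-- The twist depends on the base element and not on the position, so a lifted tuple has exactly the
equalities of the original one. -/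
theorem edgeLabel_liftConstraint {q : Constraint X × Fin N} {a : X} :
    edgeLabel (Y := cover X N τ) (a, τ q.1 a q.2) (liftConstraint τ q) = edgeLabel a q.1 := by
  have : ∀ i, ((q.1.args i, τ q.1 (q.1.args i) q.2) : X × Fin N) = (a, τ q.1 a q.2) ↔
      q.1.args i = a := fun i => ⟨congrArg Prod.fst, fun h => by rw [h]⟩
  simp only [edgeLabel, liftConstraint]
  congr 2
  exact Set.ext this

theorem map_filter_val_eq {α β γ : Type*} [Fintype α] [Fintype β] {p : α → Prop} {p' : β → Prop}
    [DecidablePred p] [DecidablePred p'] {g : β → γ} {h : α → γ} (F : α → β)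
    (hp : ∀ a, p a → p' (F a)) (hF : ∀ a a', F a = F a' → a = a')
    (hp' : ∀ b, p' b → ∃ a, p a ∧ F a = b) (hg : ∀ a, p a → g (F a) = h a) :
    (Finset.univ.filter p').val.map g = (Finset.univ.filter p).val.map h := by
  classical
  have ht : Finset.univ.filter p' = (Finset.univ.filter p).image F := by
    ext b
    simp only [Finset.mem_filter, Finset.mem_univ, true_and, Finset.mem_image]
    exact ⟨hp' b, by rintro ⟨a, ha, rfl⟩; exact hp a ha⟩
  rw [ht, Finset.image_val_of_injOn fun a _ a' _ h => hF a a' h, Multiset.map_map]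
  exact Multiset.map_congr rfl fun a ha => hg a (Finset.mem_filter.1 ha).2

theorem homomorphic_cover_one (X : FinStruct.{u} L) {N : ℕ} (hN : 0 < N) :
    Homomorphic X (cover X N fun _ _ => 1) :=
  ⟨{ toFun := fun x => ((x, ⟨0, hN⟩) : X × Fin N)
     map_fun' := fun f => isEmptyElim f
     map_rel' := fun _ x h => relMap_cover.2 ⟨x, h, ⟨0, hN⟩, rfl⟩ }⟩

variable [Finite (Σ n, L.Relations n)]

/-- The projection of a cover preserves iterated degrees. -/
theorem iterDeg_cover [IsEmpty (L.Relations 0)] (j : ℕ) :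
    (∀ (a : X) (t : Fin N), iterDeg (cover X N τ) j (.inl (a, t)) = iterDeg X j (.inl a)) ∧
    ∀ q : Constraint X × Fin N,
      iterDeg (cover X N τ) j (.inr (liftConstraint τ q)) = iterDeg X j (.inr q.1) := by
  classical
  induction j with
  | zero => exact ⟨fun _ _ => rfl, fun _ => rfl⟩
  | succ j ih =>
    constructor
    · intro a t
      -- Above each constraint through `a`, exactly one sheet passes through `(a, t)`.
      refine map_filter_val_eq (fun c => liftConstraint τ (c, (τ c a).symm t)) ?_ ?_ ?_ ?_
      · exact fun c hc => mem_scope_liftConstraint.2 ⟨hc, by simp⟩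
      · exact fun c c' h => congrArg Prod.fst (liftConstraint_bijective.1 h)
      · intro d hd
        obtain ⟨q, rfl⟩ := liftConstraint_bijective.2 d
        obtain ⟨ha, rfl⟩ := mem_scope_liftConstraint.1 hd
        exact ⟨q.1, ha, by simp⟩
      · intro c hc
        refine Prod.ext ?_ (ih.2 _)
        have := edgeLabel_liftConstraint (τ := τ) (q := (c, (τ c a).symm t)) (a := a)
        simpa using this
    · intro q
      refine map_filter_val_eq ((fun a => (a, τ q.1 a q.2)) : X → cover X N τ) ?_ ?_ ?_ ?_
      · exact fun a ha => mem_scope_liftConstraint.2 ⟨ha, rfl⟩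
      · exact fun a a' h => congrArg Prod.fst h
      · rintro ⟨a, t⟩ ha
        obtain ⟨ha', rfl⟩ := mem_scope_liftConstraint.1 ha
        exact ⟨a, ha', rfl⟩
      · exact fun a _ => Prod.ext edgeLabel_liftConstraint (ih.1 _ _)

/-- Any two `N`-fold covers of a structure have the same iterated degree sequence. -/
theorem equivOne_cover [IsEmpty (L.Relations 0)] (X : FinStruct.{u} L) (N : ℕ)
    (τ τ' : Constraint X → X → Equiv.Perm (Fin N)) :
    EquivOne (cover X N τ) (cover X N τ') := by
  let l := Equiv.ofBijective _ (liftConstraint_bijective (τ := τ))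
  let l' := Equiv.ofBijective _ (liftConstraint_bijective (τ := τ'))
  refine equivOne_of_equiv (Y := cover X N τ) (Z := cover X N τ')
    (Equiv.sumCongr (Equiv.refl (X × Fin N) : cover X N τ ≃ cover X N τ') (l.symm.trans l')) ?_
  rintro (⟨a, t⟩ | d) j
  · exact ((iterDeg_cover j).1 a t).trans ((iterDeg_cover j).1 a t).symm
  · obtain ⟨q, rfl⟩ := l.surjective d
    change iterDeg _ j (.inr (l' (l.symm (l q)))) = iterDeg _ j (.inr (l q))
    rw [l.symm_apply_apply]
    exact ((iterDeg_cover j).2 q).trans ((iterDeg_cover j).2 q).symm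

end Cover

/-! ### Fractional homomorphisms and their composition -/

section FractionalHom

attribute [local instance] Fintype.ofFinite

open FirstOrder.Language.Structure

open scoped Classical

variable {L : FirstOrder.Language.{v, w}}

/-- A fractional homomorphism: a distribution `μ y` on `Z` for each element `y` of `Y`, and for each
constraint `R(x)` of `Y` a distribution `ν R x` on the tuples in the interpretation of `R` in `Z`
that respect the equalities between entries of `x`, with the right marginals. -/
structure IsFracHom (Y Z : FinStruct.{u} L) (μ : Y → Z → ℚ)
    (ν : ∀ {n : ℕ}, L.Relations n → (Fin n → Y) → (Fin n → Z) → ℚ) : Prop where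
  nonneg : ∀ y z, 0 ≤ μ y z
  sum_eq_one : ∀ y, ∑ z, μ y z = 1
  tuple_nonneg : ∀ {n : ℕ} {R : L.Relations n} {x : Fin n → Y}, RelMap R x → ∀ t, 0 ≤ ν R x t
  relMap : ∀ {n : ℕ} {R : L.Relations n} {x : Fin n → Y}, RelMap R x → ∀ t, ν R x t ≠ 0 →
    RelMap R t
  args_eq : ∀ {n : ℕ} {R : L.Relations n} {x : Fin n → Y}, RelMap R x → ∀ t, ν R x t ≠ 0 →
    ∀ i j, x i = x j → t i = t j
  marginal : ∀ {n : ℕ} {R : L.Relations n} {x : Fin n → Y}, RelMap R x → ∀ i z,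
    ∑ t : Fin n → Z with t i = z, ν R x t = μ (x i) z

/-- There is a fractional homomorphism from `Y` to `Z`. -/
def FracHomomorphic (Y Z : FinStruct.{u} L) : Prop :=
  ∃ (μ : Y → Z → ℚ) (ν : ∀ {n : ℕ}, L.Relations n → (Fin n → Y) → (Fin n → Z) → ℚ),
    IsFracHom Y Z μ ν

theorem FracHomomorphic.refl (Y : FinStruct.{u} L) : FracHomomorphic Y Y := by
  refine ⟨fun y z => if y = z then 1 else 0, fun _ x t => if x = t then 1 else 0, ?_⟩
  constructor
  · intro y z
    split_ifs <;> simp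
  · simp
  · intro n R x _ t
    dsimp only
    split_ifs <;> simp
  · intro n R x h t ht
    obtain rfl : x = t := by simpa using ht
    exact h
  · intro n R x h t ht
    obtain rfl : x = t := by simpa using ht
    exact fun _ _ => id
  · intro n R x h i z
    simp [Finset.sum_ite_eq]

theorem FracHomomorphic.comp_hom {Y Y' Z : FinStruct.{u} L} (h : Homomorphic Y Y')
    (h' : FracHomomorphic Y' Z) : FracHomomorphic Y Z := by
  obtain ⟨φ⟩ := h
  obtain ⟨μ, ν, hμ⟩ := h'
  refine ⟨fun y => μ (φ y), fun R x => ν R (φ ∘ x), ?_⟩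
  constructor
  · exact fun y => hμ.nonneg _
  · exact fun y => hμ.sum_eq_one _
  · exact fun h => hμ.tuple_nonneg (φ.map_rel _ _ h)
  · exact fun h => hμ.relMap (φ.map_rel _ _ h)
  · exact fun h t ht i j hij => hμ.args_eq (φ.map_rel _ _ h) t ht i j (congrArg φ hij)
  · exact fun h => hμ.marginal (φ.map_rel _ _ h)

variable [Finite (Σ n, L.Relations n)] [IsEmpty (L.Relations 0)]

/-- The elements of `Y'` with the same iterated degrees as the element `y` of `Y`. -/
noncomputable def elemClass (Y' : FinStruct.{u} L) {Y : FinStruct.{u} L} (y : Y) : Finset Y' :=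
  {z | ∀ j, iterDeg Y' j (.inl z) = iterDeg Y j (.inl y)}

/-- The tuples of the constraints of `Y'` with symbol `R` and with the same iterated degrees as the
constraint `R(x)` of `Y`. -/
noncomputable def tupleClass (Y' : FinStruct.{u} L) {Y : FinStruct.{u} L} {n : ℕ} (R : L.Relations n)
    (x : Fin n → Y) : Finset (Fin n → Y') :=
  {x' | ∃ (h : RelMap R x) (h' : RelMap R x'),
    ∀ j, iterDeg Y' j (.inr ⟨n, R, x', h'⟩) = iterDeg Y j (.inr ⟨n, R, x, h⟩)}

omit [IsEmpty (L.Relations 0)] in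
theorem mem_elemClass {Y Y' : FinStruct.{u} L} {y : Y} {z : Y'} :
    z ∈ elemClass Y' y ↔ ∀ j, iterDeg Y' j (.inl z) = iterDeg Y j (.inl y) := by
  simp [elemClass]

omit [IsEmpty (L.Relations 0)] in
theorem mem_tupleClass {Y Y' : FinStruct.{u} L} {n : ℕ} {R : L.Relations n}
    {x : Fin n → Y} {x' : Fin n → Y'} : x' ∈ tupleClass Y' R x ↔
      ∃ (h : RelMap R x) (h' : RelMap R x'),
        ∀ j, iterDeg Y' j (.inr ⟨n, R, x', h'⟩) = iterDeg Y j (.inr ⟨n, R, x, h⟩) := by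
  simp [tupleClass]

/-- A uniformly distributed tuple of a class has uniformly distributed entries. -/
theorem sum_tupleClass {Y Y' : FinStruct.{u} L} {n : ℕ} {R : L.Relations n} {x : Fin n → Y}
    (h : RelMap R x) (i : Fin n) (hne : (tupleClass Y' R x).Nonempty) (f : Y' → ℚ) :
    (∑ x' ∈ tupleClass Y' R x, f (x' i)) / (tupleClass Y' R x).card =
      (∑ z ∈ elemClass Y' (x i), f z) / (elemClass Y' (x i)).card := by
  have hmem : ∀ x' ∈ tupleClass Y' R x, x' i ∈ elemClass Y' (x i) := by
    intro x' hx'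
    obtain ⟨h, h', hj⟩ := mem_tupleClass.1 hx'
    exact mem_elemClass.2 fun j => (args_of_iterDeg_eq h h' (hj (j + 1)) i).1
  obtain ⟨x₀, hx₀⟩ := hne
  -- The map from tuples of the class to their `i`-th entry has all fibres of this same size `m`;
  -- the case `f = 1` below gives the ratio of the class sizes, and `m` cancels.
  let m := ((tupleClass Y' R x).filter fun x' => x' i = x₀ i).card
  have hm : 0 < m := Finset.card_pos.2 ⟨x₀, by simp [hx₀]⟩
  have hcard : ∀ z ∈ elemClass Y' (x i), ((tupleClass Y' R x).filter fun x' => x' i = z).card = m := by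
    intro z hz
    have h1 := card_constraints_eq (R := R) ⟨n, R, x, h⟩ i (z := z) (z' := x₀ i) fun j =>
      (mem_elemClass.1 hz j).trans (mem_elemClass.1 (hmem x₀ hx₀) j).symm
    have h2 : ∀ z : Y', (tupleClass Y' R x).filter (fun x' => x' i = z) =
        Finset.univ.filter fun x' : Fin n → Y' => (∃ h' : RelMap R x',
          ∀ j, iterDeg Y' j (.inr ⟨n, R, x', h'⟩) = iterDeg Y j (.inr ⟨n, R, x, h⟩)) ∧ x' i = z := by
      intro z
      ext x'
      simp [mem_tupleClass, h]
    simp only [m, h2]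
    exact h1
  have h1 : ∀ f : Y' → ℚ, ∑ x' ∈ tupleClass Y' R x, f (x' i) =
      m * ∑ z ∈ elemClass Y' (x i), f z := by
    intro f
    rw [← Finset.sum_fiberwise_of_maps_to hmem, Finset.mul_sum]
    refine Finset.sum_congr rfl fun z hz => ?_
    rw [← hcard z hz, ← nsmul_eq_mul, ← Finset.sum_const]
    exact Finset.sum_congr rfl fun x' hx' => by rw [(Finset.mem_filter.1 hx').2]
  have h2 := h1 fun _ => 1
  simp only [Finset.sum_const, nsmul_eq_mul, mul_one] at h2
  rw [h1, h2, mul_div_mul_left _ _ (by positivity)]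

/-- Each element or constraint of `Y` receives the average of the distributions of its class in
`Y'`, which is nonempty by `≡₁`. The marginals match because a uniform tuple of a class has uniform
entries (`sum_tupleClass`). -/
theorem FracHomomorphic.comp_equivOne {Y Y' Z : FinStruct.{u} L} (h : EquivOne Y Y')
    (h' : FracHomomorphic Y' Z) : FracHomomorphic Y Z := by
  obtain ⟨μ, ν, hμ⟩ := h'
  have hclass : ∀ {n : ℕ} {R : L.Relations n} {x : Fin n → Y}, RelMap R x →
      (tupleClass Y' R x).Nonempty := by
    intro n R x hx
    obtain ⟨d, hd⟩ := h.exists_constraint ⟨n, R, x, hx⟩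
    obtain ⟨x', h', rfl⟩ := exists_args_of_iterDeg_eq hx (hd 1)
    exact ⟨x', mem_tupleClass.2 ⟨hx, h', hd⟩⟩
  have hsupp : ∀ {n : ℕ} {R : L.Relations n} {x : Fin n → Y} {t : Fin n → Z},
      (∑ x' ∈ tupleClass Y' R x, ν R x' t) / (tupleClass Y' R x).card ≠ 0 →
      ∃ x' ∈ tupleClass Y' R x, ν R x' t ≠ 0 := fun ht =>
    Finset.exists_ne_zero_of_sum_ne_zero (div_ne_zero_iff.1 ht).1
  refine ⟨fun y w => (∑ z ∈ elemClass Y' y, μ z w) / (elemClass Y' y).card,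
    fun R x t => (∑ x' ∈ tupleClass Y' R x, ν R x' t) / (tupleClass Y' R x).card, ?_⟩
  constructor
  · exact fun y w => div_nonneg (Finset.sum_nonneg fun z _ => hμ.nonneg z w) (by positivity)
  · intro y
    obtain ⟨z, hz⟩ := h.exists_elem y
    have hne : (elemClass Y' y).card ≠ 0 := Finset.card_ne_zero.2 ⟨z, mem_elemClass.2 hz⟩
    rw [← Finset.sum_div, Finset.sum_comm]
    simp [hμ.sum_eq_one, hne]
  · intro n R x hx t
    refine div_nonneg (Finset.sum_nonneg fun x' hx' => ?_) (by positivity)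
    obtain ⟨-, h', -⟩ := mem_tupleClass.1 hx'
    exact hμ.tuple_nonneg h' t
  · intro n R x hx t ht
    obtain ⟨x', hx', ht'⟩ := hsupp ht
    obtain ⟨-, h', -⟩ := mem_tupleClass.1 hx'
    exact hμ.relMap h' t ht'
  · intro n R x hx t ht i j hij
    obtain ⟨x', hx', ht'⟩ := hsupp ht
    obtain ⟨h, h', hd⟩ := mem_tupleClass.1 hx'
    exact hμ.args_eq h' t ht' i j (((args_of_iterDeg_eq h h' (hd 1) j).2 i).2 hij)
  · intro n R x hx i w
    rw [← sum_tupleClass hx i (hclass hx), ← Finset.sum_div, Finset.sum_comm]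
    congr 1
    refine Finset.sum_congr rfl fun x' hx' => ?_
    obtain ⟨-, h', -⟩ := mem_tupleClass.1 hx'
    exact hμ.marginal h' i w

end FractionalHom

/-! ### Rational distributions as lists of samples -/

section Sampling

attribute [local instance] Fintype.ofFinite

open scoped Classical

/-- Finitely many rational distributions are realized by samples of a common size. -/
theorem exists_samples {ι : Type*} [Finite ι] {T : ι → Type*} [∀ i, Fintype (T i)]
    (w : ∀ i, T i → ℚ) (hw : ∀ i f, 0 ≤ w i f) (hw' : ∀ i, ∑ f, w i f = 1) :
    ∃ N : ℕ, 0 < N ∧ ∃ F : ∀ i, Fin N → T i,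
      ∀ i f, (({s | F i s = f} : Finset (Fin N)).card : ℚ) = N * w i f := by
  -- A common denominator of all the weights.
  let N : ℕ := ∏ q : Σ i, T i, (w q.1 q.2).den
  have hN : 0 < N := Finset.prod_pos fun q _ => (w q.1 q.2).den_pos
  have hn : ∀ i f, ∃ m : ℕ, (m : ℚ) = N * w i f := by
    intro i f
    obtain ⟨M, hM⟩ : (w i f).den ∣ N :=
      Finset.dvd_prod_of_mem (fun q : Σ i, T i => (w q.1 q.2).den) (Finset.mem_univ ⟨i, f⟩)
    refine ⟨M * (w i f).num.toNat, ?_⟩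
    have h1 : (((w i f).num.toNat : ℤ) : ℚ) = (w i f).num := by
      rw [Int.toNat_of_nonneg (Rat.num_nonneg.2 (hw i f))]
    have h2 := Rat.den_mul_eq_num (w i f)
    rw [hM]
    push_cast at h1 ⊢
    rw [h1, ← h2]
    ring
  choose n hn using hn
  have hsum : ∀ i, ∑ f, n i f = N := by
    intro i
    have : ((∑ f, n i f : ℕ) : ℚ) = N := by
      push_cast
      simp only [hn, ← Finset.mul_sum, hw', mul_one]
    exact_mod_cast this
  have e : ∀ i, Nonempty (Fin N ≃ Σ f, Fin (n i f)) := fun i =>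
    Fintype.card_eq.1 (by simp [hsum])
  refine ⟨N, hN, fun i s => ((e i).some s).1, fun i f => ?_⟩
  rw [← hn]
  congr 1
  rw [← Fintype.card_subtype, ← Fintype.card_fin (n i f)]
  refine Fintype.card_congr ?_
  exact ((e i).some.subtypeEquivOfSubtype (p := fun q => q.1 = f)).trans (Equiv.sigmaSubtype f)

theorem exists_perm_of_card_fiber_eq {α T : Type*} [Fintype α] (F G : α → T)
    (h : ∀ t, ({s | F s = t} : Finset α).card = ({s | G s = t} : Finset α).card) :
    ∃ σ : Equiv.Perm α, ∀ s, F s = G (σ s) := by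
  have e : ∀ t, Nonempty ({s // F s = t} ≃ {s // G s = t}) := fun t =>
    Fintype.card_eq.1 (by rw [Fintype.card_subtype, Fintype.card_subtype, h])
  exact ⟨Equiv.ofFiberEquiv fun t => (e t).some, fun s => (Equiv.ofFiberEquiv_map _ s).symm⟩

end Sampling

/-! ### Maps acting on tuples and constraints -/

section Star

attribute [local instance] Fintype.ofFinite

open FirstOrder.Language.Structure

open scoped Classical

variable {L : FirstOrder.Language.{v, w}} {k : ℕ} {X A : FinStruct.{u} L}

/-- The set of entries of a tuple or of a constraint. -/
def StarCarrier.scope : StarCarrier k X → Set X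
  | .tuple _ a => Set.range a
  | .constraint c => c.scope

/-- The map `f` sends the tuple or constraint `y` over `X` to the tuple or constraint `z` over `A`. -/
inductive Eval {V : Set X} (f : V → A) : StarCarrier k X → StarCarrier k A → Prop
  | tuple (j : Fin k) (a : Fin (j + 1) → X) (h : ∀ i, a i ∈ V) :
      Eval f (.tuple j a) (.tuple j fun i => f ⟨a i, h i⟩)
  | constraint (c : Constraint X) (h : ∀ i, c.args i ∈ V)
      (hf : RelMap c.symbol fun i => f ⟨c.args i, h i⟩) :
      Eval f (.constraint c) (.constraint ⟨c.arity, c.symbol, fun i => f ⟨c.args i, h i⟩, hf⟩)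

namespace Eval

theorem map_unique {y : StarCarrier k X} {z : StarCarrier k A} {f f' : y.scope → A}
    (h : Eval f y z) (h' : Eval f' y z) : f = f' := by
  cases h with
  | tuple j a h =>
    generalize hz : (StarCarrier.tuple j fun i => f ⟨a i, h i⟩ : StarCarrier k A) = z at h'
    cases h' with
    | tuple j a h' =>
      have hz := eq_of_heq (StarCarrier.tuple.inj hz).2
      funext ⟨_, i, rfl⟩
      exact congrFun hz i
  | constraint c h hf =>
    generalize hz : (StarCarrier.constraint ⟨c.arity, c.symbol, fun i => f ⟨c.args i, h i⟩, hf⟩ :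
      StarCarrier k A) = z at h'
    cases h' with
    | constraint c h' hf' =>
      have hz := eq_of_heq (Constraint.mk.inj (StarCarrier.constraint.inj hz)).2.2
      funext ⟨_, i, rfl⟩
      exact congrFun hz i

theorem comp_inclusion_iff {U V : Set X} (hUV : U ⊆ V) {f : V → A} {y : StarCarrier k X}
    (hy : y.scope ⊆ U) {z : StarCarrier k A} :
    Eval (f ∘ Set.inclusion hUV) y z ↔ Eval f y z := by
  constructor
  · rintro (⟨j, a, h⟩ | ⟨c, h, hf⟩)
    · exact .tuple j a fun i => hUV (h i)
    · exact .constraint c (fun i => hUV (h i)) hf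
  · rintro (⟨j, a, h⟩ | ⟨c, h, hf⟩)
    · exact .tuple j a fun i => hy ⟨i, rfl⟩
    · exact .constraint c (fun i => hy ⟨i, rfl⟩) hf

end Eval

variable [Finite (Σ n, L.Relations n)]

instance [IsEmpty (L.Relations 0)] : IsEmpty ((starLang L k).Relations 0) :=
  ⟨fun r => nomatch (r : StarRel L k 0)⟩

/-- The first entry of a constraint of `X^{*ₖ}` determines the others. -/
theorem Eval.of_zero {n : ℕ} {r : (starLang L k).Relations (n + 1)} {x : Fin (n + 1) → star k X}
    (hx : RelMap r x) {t : Fin (n + 1) → star k A} (ht : RelMap r t) {V : Set X} {f : V → A}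
    (h : Eval f (x 0) (t 0)) (i : Fin (n + 1)) : Eval f (x i) (t i) := by
  change StarRel L k (n + 1) at r
  cases r with
  | tupleEq j S => rwa [show i = 0 from Fin.ext (by omega)]
  | constraintEq R S => rwa [show i = 0 from Fin.ext (by omega)]
  | tupleProj j j' e =>
    obtain ⟨a, hx0, hx1⟩ := hx
    obtain ⟨b, ht0, ht1⟩ := ht
    rw [hx0, ht0] at h
    generalize hz : (StarCarrier.tuple j b : StarCarrier k A) = z at h
    cases h with
    | tuple j a ha =>
      obtain rfl := eq_of_heq (StarCarrier.tuple.inj hz).2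
      fin_cases i
      · exact hx0 ▸ ht0 ▸ .tuple j a ha
      · exact hx1 ▸ ht1 ▸ .tuple j' (a ∘ e) fun i => ha (e i)
  | constraintProj R j e =>
    obtain ⟨a, ha, hx0, hx1⟩ := hx
    obtain ⟨b, hb, ht0, ht1⟩ := ht
    rw [hx0, ht0] at h
    generalize hz : (StarCarrier.constraint ⟨_, R, b, hb⟩ : StarCarrier k A) = z at h
    generalize hy : (StarCarrier.constraint ⟨_, R, a, ha⟩ : StarCarrier k X) = y at h
    cases h with
    | tuple => cases hy
    | constraint c hc hf =>
      obtain rfl := StarCarrier.constraint.inj hy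
      obtain rfl := eq_of_heq (Constraint.mk.inj (StarCarrier.constraint.inj hz)).2.2
      fin_cases i
      · exact hx0 ▸ ht0 ▸ .constraint _ hc hf
      · exact hx1 ▸ ht1 ▸ .tuple j (a ∘ e) fun i => hc (e i)

/-- Applying one map to all entries commutes with projections and keeps equalities between
positions. -/
theorem relMap_of_eval {n : ℕ} {r : (starLang L k).Relations n} {x : Fin n → star k X}
    (hx : RelMap r x) {t : Fin n → star k A} {V : Set X} {f : V → A}
    (h : ∀ i, Eval f (x i) (t i)) : RelMap r t := by
  change StarRel L k n at r
  cases r with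
  | tupleEq j S =>
    obtain ⟨a, ha, hx0⟩ := hx
    have h0 := h 0
    rw [hx0] at h0
    generalize hz : t 0 = z at h0
    cases h0 with
    | tuple j a hV => exact ⟨_, fun i hi i' hi' => by simp only [ha i hi i' hi'], hz⟩
  | constraintEq R S =>
    obtain ⟨a, hR, ha, hx0⟩ := hx
    have h0 := h 0
    rw [hx0] at h0
    generalize hz : t 0 = z at h0
    cases h0 with
    | constraint c hV hf => exact ⟨_, hf, fun i hi i' hi' => by simp only [ha i hi i' hi'], hz⟩
  | tupleProj j j' e =>
    obtain ⟨a, hx0, hx1⟩ := hx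
    have h0 := h 0
    have h1 := h 1
    rw [hx0] at h0
    rw [hx1] at h1
    generalize hz : t 0 = z at h0
    generalize hz' : t 1 = z' at h1
    cases h0 with
    | tuple j a hV =>
      cases h1 with
      | tuple j' a' hV' => exact ⟨_, hz, hz'⟩
  | constraintProj R j e =>
    obtain ⟨a, hR, hx0, hx1⟩ := hx
    have h0 := h 0
    have h1 := h 1
    rw [hx0] at h0
    rw [hx1] at h1
    generalize hz : t 0 = z at h0
    generalize hz' : t 1 = z' at h1
    cases h0 with
    | constraint c hV hf =>
      cases h1 with
      | tuple j' a' hV' => exact ⟨_, hf, hz, hz'⟩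

/-- An entry of a constraint of `X^{*ₖ}` is its first entry, or a tuple with entries among those of
the first entry. -/
theorem eq_or_tuple_of_relMap {n : ℕ} {r : (starLang L k).Relations (n + 1)}
    {x : Fin (n + 1) → star k X} (hx : RelMap r x) (i : Fin (n + 1)) :
    x i = x 0 ∨ ∃ (j : Fin k) (a : Fin (j + 1) → X), x i = StarCarrier.tuple j a ∧
      Set.range a ⊆ StarCarrier.scope (x 0) := by
  change StarRel L k (n + 1) at r
  cases r with
  | tupleEq j S => exact Or.inl (congrArg x (Fin.ext (by omega)))
  | constraintEq R S => exact Or.inl (congrArg x (Fin.ext (by omega)))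
  | tupleProj j j' e =>
    obtain ⟨a, hx0, hx1⟩ := hx
    fin_cases i
    · exact Or.inl rfl
    · exact Or.inr ⟨j', a ∘ e, hx1, hx0 ▸ Set.range_comp_subset_range e a⟩
  | constraintProj R j e =>
    obtain ⟨a, hR, hx0, hx1⟩ := hx
    fin_cases i
    · exact Or.inl rfl
    · exact Or.inr ⟨j, a ∘ e, hx1, hx0 ▸ Set.range_comp_subset_range e a⟩

/-- A tuple or constraint `z` over `A` with the unary relations of `y` is the image of `y`. -/
theorem exists_eval {y : star k X} {z : star k A}
    (h : ∀ r : (starLang L k).Relations 1, RelMap r (fun _ => y) → RelMap r fun _ => z) :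
    ∃ f : StarCarrier.scope y → A, Eval f y z := by
  have key : ∀ {m : ℕ} (a : Fin m → X) (b : Fin m → A), (∀ i i', a i = a i' → b i = b i') →
      ∃ f : Set.range a → A, (fun i => f ⟨a i, i, rfl⟩) = b := fun a b hab =>
    ⟨fun v => b v.2.choose, funext fun i => hab _ _ (Exists.choose_spec (⟨i, rfl⟩ : a i ∈ Set.range a))⟩
  cases y with
  | tuple j a =>
    obtain ⟨b, -, hz⟩ := h (StarRel.tupleEq j ∅) ⟨a, by simp, rfl⟩
    obtain ⟨f, hf⟩ := key a b fun i i' hi => by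
      -- The empty set of positions only fixes the length; the two-element sets carry over the
      -- equalities, which make the map well defined.
      obtain ⟨b', hb', hz'⟩ := h (StarRel.tupleEq j {i, i'}) ⟨a, by simp [hi], rfl⟩
      obtain rfl := eq_of_heq (StarCarrier.tuple.inj (hz.symm.trans hz')).2
      exact hb' i (by simp) i' (by simp)
    refine ⟨f, ?_⟩
    rw [show z = StarCarrier.tuple j b from hz, ← hf]
    exact .tuple j a fun i => Set.mem_range_self i
  | constraint c =>
    obtain ⟨n, R, a, ha⟩ := c
    obtain ⟨b, hb, -, hz⟩ := h (StarRel.constraintEq R ∅) ⟨a, ha, by simp, rfl⟩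
    obtain ⟨f, hf⟩ := key a b fun i i' hi => by
      obtain ⟨b', hb, hb', hz'⟩ := h (StarRel.constraintEq R {i, i'}) ⟨a, ha, by simp [hi], rfl⟩
      obtain rfl := eq_of_heq
        (Constraint.mk.inj (StarCarrier.constraint.inj (hz.symm.trans hz'))).2.2
      exact hb' i (by simp) i' (by simp)
    refine ⟨f, ?_⟩
    subst hf
    rw [show z = StarCarrier.constraint _ from hz]
    exact .constraint ⟨n, R, a, ha⟩ (fun i => Set.mem_range_self i) hb

/-- This is the purpose of the binary relations: every inclusion of scopes is recorded by a
constraint, at which the marginals of a fractional homomorphism can be compared. -/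
theorem exists_relMap_of_subset_scope {y : star k X} {j : Fin k} {a : Fin (j + 1) → X}
    (h : Set.range a ⊆ StarCarrier.scope y) :
    ∃ (r : (starLang L k).Relations 2), RelMap r ![y, StarCarrier.tuple j a] := by
  cases y with
  | tuple j' a' =>
    choose e he using fun i => h (Set.mem_range_self i)
    exact ⟨StarRel.tupleProj j' j e, a', rfl, congrArg (StarCarrier.tuple j) (funext he).symm⟩
  | constraint c =>
    choose e he using fun i => h (Set.mem_range_self i)
    exact ⟨StarRel.constraintProj c.symbol j e, c.args, c.mem, rfl,
      congrArg (StarCarrier.tuple j) (funext he).symm⟩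

/-! ### From a solution to a twisted cover -/

section Feasible

variable {p : (V : Set X) → (V → A) → ℚ} {q : (c : Constraint X) → (c.scope → A) → ℚ}

/-- The distribution on the maps from the scope of `y` to `A` in a solution of `SAᵏ(X, A)`. -/
def starWeight (p : (V : Set X) → (V → A) → ℚ) (q : (c : Constraint X) → (c.scope → A) → ℚ) :
    (y : StarCarrier k X) → (y.scope → A) → ℚ
  | .tuple _ a => p (Set.range a)
  | .constraint c => q c

omit [Finite (Σ n, L.Relations n)] in
theorem range_ncard_le (j : Fin k) (a : Fin (j + 1) → X) : (Set.range a).ncard ≤ k := by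
  rw [← Set.image_univ]
  refine (Set.ncard_image_le).trans ?_
  rw [Set.ncard_univ, Nat.card_eq_fintype_card, Fintype.card_fin]
  exact j.2

omit [Finite (Σ n, L.Relations n)] in
theorem IsSASolution.starWeight_nonneg (h : IsSASolution k X A p q) (y : StarCarrier k X)
    (f : y.scope → A) : 0 ≤ starWeight p q y f := by
  cases y with
  | tuple j a => exact (h.p_mem_Icc _ (Set.range_nonempty a) (range_ncard_le j a) f).1
  | constraint c => exact (h.q_mem_Icc c f).1

omit [Finite (Σ n, L.Relations n)] in
theorem IsSASolution.starWeight_marginal (h : IsSASolution k X A p q) (y : StarCarrier k X)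
    (j : Fin k) (a : Fin (j + 1) → X) (ha : Set.range a ⊆ y.scope) (f : Set.range a → A) :
    p (Set.range a) f = ∑ g : y.scope → A with g ∘ Set.inclusion ha = f, starWeight p q y g := by
  cases y with
  | tuple j' a' =>
    rw [h.marginal _ _ ha (Set.range_nonempty a) (range_ncard_le j' a') f]
    congr!
  | constraint c =>
    rw [h.constraint_marginal c _ ha (Set.range_nonempty a) (range_ncard_le j a) f]
    congr!
    exact congrArg (q c) (eq_of_heq ‹_›)

omit [Finite (Σ n, L.Relations n)] in
-- The system does not normalize the weights of constraints. Their total is that of the marginal on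
-- one entry, which is available since `1 ≤ k` and arities are positive.
theorem IsSASolution.starWeight_sum [IsEmpty (L.Relations 0)] (hk : 1 ≤ k)
    (h : IsSASolution k X A p q) (y : StarCarrier k X) : ∑ f, starWeight p q y f = 1 := by
  cases y with
  | tuple j a => exact h.sum_eq_one _ (Set.range_nonempty a) (range_ncard_le j a)
  | constraint c =>
    obtain ⟨i⟩ := c.nonempty_fin_arity
    let a : Fin ((⟨0, hk⟩ : Fin k) + 1) → X := fun _ => c.args i
    have ha : Set.range a ⊆ c.scope := Set.range_subset_iff.2 fun _ => ⟨i, rfl⟩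
    rw [← h.sum_eq_one (Set.range a) (Set.range_nonempty a) (range_ncard_le _ a)]
    refine (Finset.sum_fiberwise Finset.univ (fun f : c.scope → A => f ∘ Set.inclusion ha) _).symm.trans
      ?_
    simp only [h.starWeight_marginal (.constraint c) _ a ha]
    congr!
    exact congrArg (q c) (eq_of_heq ‹_›)

omit [Finite (Σ n, L.Relations n)] in
theorem IsSASolution.exists_eval (h : IsSASolution k X A p q) {y : StarCarrier k X}
    {f : y.scope → A} (hf : starWeight p q y f ≠ 0) : ∃ z, Eval f y z := by
  cases y with
  | tuple j a => exact ⟨_, .tuple j a fun i => Set.mem_range_self i⟩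
  | constraint c =>
    refine ⟨_, .constraint c (fun i => Set.mem_range_self i) ?_⟩
    by_contra hc
    exact hf (h.constraint_zero c f hc)

theorem exists_equivOne_of_feasible [IsEmpty (L.Relations 0)] (hk : 1 ≤ k)
    (h : SAFeasible k X A) :
    ∃ Y₁ Y₂ : FinStruct.{max u w} (starLang L k), Homomorphic (star k X) Y₁ ∧ EquivOne Y₁ Y₂ ∧
      Homomorphic Y₂ (star k A) := by
  obtain ⟨p, q, h⟩ := h
  obtain ⟨N, hN, F, hF⟩ := exists_samples (ι := StarCarrier k X) (fun y => starWeight p q y)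
    h.starWeight_nonneg (h.starWeight_sum hk)
  -- A map of weight zero is never sampled, so each sampled map sends constraints to constraints.
  have hev : ∀ y s, ∃ z, Eval (F y s) y z := by
    intro y s
    refine h.exists_eval fun h0 => ?_
    have h1 := hF y (F y s)
    rw [h0, mul_zero, Nat.cast_eq_zero, Finset.card_eq_zero] at h1
    exact Finset.notMem_empty s (h1 ▸ by simp)
  choose φ hφ using hev
  -- The twist matches the samples at the first entry, restricted to the scope of `y`, with the
  -- samples at `y`. The index `i₀` of value 0 stands in for a literal zero, as the arity is a
  -- variable.
  have hτ : ∀ (c : Constraint (star k X)) (y : star k X), ∃ σ : Equiv.Perm (Fin N), ∀ i i₀ : Fin c.arity,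
      (i₀ : ℕ) = 0 → c.args i = y → ∃ hy : StarCarrier.scope y ⊆ StarCarrier.scope (c.args i₀),
        ∀ s, F (c.args i₀) s ∘ Set.inclusion hy = F y (σ s) := by
    rintro ⟨_ | n, r, x, hx⟩ y
    · exact ⟨1, fun i => i.elim0⟩
    by_cases hy : ∃ i, x i = y
    swap
    · exact ⟨1, fun i _ _ hi => absurd ⟨i, hi⟩ hy⟩
    obtain ⟨i, rfl⟩ := hy
    suffices H : ∃ hy : StarCarrier.scope (x i) ⊆ StarCarrier.scope (x 0), ∃ σ : Equiv.Perm (Fin N),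
        ∀ s, F (x 0) s ∘ Set.inclusion hy = F (x i) (σ s) by
      obtain ⟨hy, σ, hσ⟩ := H
      refine ⟨σ, fun i' i₀ hi₀ hi' => ?_⟩
      obtain rfl : i₀ = (0 : Fin (n + 1)) := Fin.ext hi₀
      exact ⟨hy, hσ⟩
    rcases eq_or_tuple_of_relMap hx i with hi | ⟨j, a, hi, ha⟩
    · rw [hi]
      exact ⟨subset_rfl, 1, fun s => rfl⟩
    · rw [hi]
      refine ⟨ha, exists_perm_of_card_fiber_eq _ _ fun f => ?_⟩
      have h1 := h.starWeight_marginal (x 0) j a ha f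
      have h2 := hF (.tuple j a) f
      -- By the marginal condition, `f` occurs equally often among the restricted samples and the
      -- samples of the tuple.
      have h3 : (({s | F (x 0) s ∘ Set.inclusion ha = f} : Finset (Fin N)).card : ℚ) =
          N * p (Set.range a) f := by
        rw [h1, Finset.mul_sum, Finset.card_eq_sum_card_fiberwise (f := F (x 0))
          (t := {g | g ∘ Set.inclusion ha = f}) (fun s hs => by simpa using hs), Nat.cast_sum]
        refine Finset.sum_congr (by ext; simp) fun g hg => ?_
        refine Eq.trans ?_ (hF (x 0) g)
        rw [Finset.filter_filter]
        congr 2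
        ext s
        simp only [Finset.mem_filter, Finset.mem_univ, true_and] at hg ⊢
        exact ⟨And.right, fun hs => ⟨hs ▸ hg, hs⟩⟩
      exact_mod_cast h3.trans h2.symm
  choose τ hτ using hτ
  refine ⟨cover (star k X) N fun _ _ => 1, cover (star k X) N τ, homomorphic_cover_one _ hN,
    equivOne_cover _ _ _ _, ⟨⟨fun v => φ v.1 v.2, fun f => isEmptyElim f, ?_⟩⟩⟩
  rintro (_ | n) r _ ⟨x, hx, s, rfl⟩
  · exact relMap_of_eval (V := ∅) (f := fun v => v.2.elim) hx fun i => i.elim0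
  -- In sheet `s`, the twist makes the sample used at every entry a restriction of the single map `F
  -- (x 0) s`.
  · refine relMap_of_eval (f := F (x 0) s) hx fun i => ?_
    obtain ⟨hy, hs⟩ := hτ ⟨n + 1, r, x, hx⟩ (x i) i (0 : Fin (n + 1)) rfl rfl
    have := hφ (x i) (τ ⟨n + 1, r, x, hx⟩ (x i) s)
    rw [← hs s] at this
    exact (Eval.comp_inclusion_iff hy subset_rfl).1 this

end Feasible

/-! ### From a fractional homomorphism to a solution -/

section FracHom

variable {μ : star k X → star k A → ℚ}
  {ν : ∀ {n : ℕ}, (starLang L k).Relations n → (Fin n → star k X) → (Fin n → star k A) → ℚ}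

/-- The marginal at a unary constraint on `y` places `z` in the same unary relation. -/
theorem IsFracHom.exists_eval (h : IsFracHom (star k X) (star k A) μ ν) {y : star k X}
    {z : star k A} (hz : μ y z ≠ 0) : ∃ f : StarCarrier.scope y → A, Eval f y z := by
  refine SheraliAdams.exists_eval fun r hr => ?_
  rw [← h.marginal hr 0 z] at hz
  obtain ⟨t, ht, ht'⟩ := Finset.exists_ne_zero_of_sum_ne_zero hz
  have ht0 : t 0 = z := (Finset.mem_filter.1 ht).2
  have : t = fun _ => z := funext fun i => by rw [← ht0, Subsingleton.elim i 0]
  exact this ▸ h.relMap hr t ht'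

/-- The weight of the map `f` that is induced by the distribution `μ y`. -/
noncomputable def evalWeight (μ : star k X → star k A → ℚ) (y : star k X) {V : Set X} (f : V → A) :
    ℚ :=
  ∑ z : star k A, if Eval f y z then μ y z else 0

theorem IsFracHom.evalWeight_nonneg (h : IsFracHom (star k X) (star k A) μ ν) (y : star k X)
    {V : Set X} (f : V → A) : 0 ≤ evalWeight μ y f :=
  Finset.sum_nonneg fun z _ => by split_ifs <;> simp [h.nonneg]

theorem IsFracHom.sum_evalWeight (h : IsFracHom (star k X) (star k A) μ ν) {y : star k X}
    {V : Set X} (hV : StarCarrier.scope y = V) : ∑ f : V → A, evalWeight μ y f = 1 := by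
  subst hV
  rw [← h.sum_eq_one y]
  unfold evalWeight
  rw [Finset.sum_comm]
  refine Finset.sum_congr rfl fun z _ => ?_
  by_cases hz : μ y z = 0
  · simp [hz]
  · obtain ⟨f, hf⟩ := h.exists_eval hz
    rw [Finset.sum_eq_single f (fun g _ hg => if_neg fun hg' => hg (hg'.map_unique hf)) (by simp),
      if_pos hf]

theorem IsFracHom.evalWeight_le_one (h : IsFracHom (star k X) (star k A) μ ν) {y : star k X}
    {V : Set X} (hV : StarCarrier.scope y = V) (f : V → A) : evalWeight μ y f ≤ 1 := by
  rw [← h.sum_evalWeight hV]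
  exact Finset.single_le_sum (fun g _ => h.evalWeight_nonneg y g) (Finset.mem_univ f)

theorem IsFracHom.evalWeight_eq_sum_tuples (h : IsFracHom (star k X) (star k A) μ ν) {n : ℕ}
    {r : (starLang L k).Relations n} {x : Fin n → star k X} (hx : RelMap r x) (i : Fin n)
    {V : Set X} (f : V → A) :
    evalWeight μ (x i) f = ∑ t : Fin n → star k A, if Eval f (x i) (t i) then ν r x t else 0 := by
  rw [← Finset.sum_fiberwise Finset.univ fun t : Fin n → star k A => t i]
  refine Finset.sum_congr rfl fun z _ => ?_
  rw [← h.marginal hx i z]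
  split_ifs with hz
  · exact Finset.sum_congr rfl fun t ht => by rw [(Finset.mem_filter.1 ht).2, if_pos hz]
  · exact (Finset.sum_eq_zero fun t ht => by rw [(Finset.mem_filter.1 ht).2, if_neg hz]).symm

/-- Both sides expand over the pairs in a binary relation joining `y` to the tuple. For a pair of
nonzero weight, a unique map evaluates `y` to the first entry, and its restriction is the unique map
that evaluates the tuple to the second. -/
theorem IsFracHom.evalWeight_marginal (h : IsFracHom (star k X) (star k A) μ ν)
    {y : star k X} {j : Fin k} {a : Fin (j + 1) → X} {U V : Set X} (hU : Set.range a = U)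
    (hV : StarCarrier.scope y = V) (hUV : U ⊆ V) (f : U → A) :
    evalWeight μ (StarCarrier.tuple j a) f =
      ∑ g : V → A with g ∘ Set.inclusion hUV = f, evalWeight μ y g := by
  subst hU hV
  obtain ⟨r, hr⟩ := exists_relMap_of_subset_scope (j := j) (a := a) hUV
  have h0 : ∀ g : StarCarrier.scope y → A, evalWeight μ y g = ∑ t : Fin 2 → star k A,
      if Eval g y (t 0) then ν r ![y, StarCarrier.tuple j a] t else 0 :=
    fun g => h.evalWeight_eq_sum_tuples hr 0 g
  have h1 : evalWeight μ (StarCarrier.tuple j a) f = ∑ t : Fin 2 → star k A,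
      if Eval f (StarCarrier.tuple j a) (t 1) then ν r ![y, StarCarrier.tuple j a] t else 0 :=
    h.evalWeight_eq_sum_tuples hr 1 f
  simp only [h0]
  rw [h1, Finset.sum_comm]
  refine Finset.sum_congr rfl fun t _ => ?_
  by_cases ht : ν r ![y, StarCarrier.tuple j a] t = 0
  · simp [ht]
  have hy : μ y (t 0) ≠ 0 := by
    intro h0
    rw [← show μ (![y, StarCarrier.tuple j a] 0) (t 0) = μ y (t 0) from rfl, ← h.marginal hr,
      Finset.sum_eq_zero_iff_of_nonneg fun t _ => h.tuple_nonneg hr t] at h0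
    exact ht (h0 t (by simp))
  obtain ⟨g₀, hg₀⟩ := h.exists_eval hy
  have hg₁ : Eval (g₀ ∘ Set.inclusion hUV) (StarCarrier.tuple j a : StarCarrier k X) (t 1) :=
    (Eval.comp_inclusion_iff hUV subset_rfl).2 (Eval.of_zero hr (h.relMap hr t ht) hg₀ 1)
  have hiff : Eval f (StarCarrier.tuple j a : StarCarrier k X) (t 1) ↔
      g₀ ∘ Set.inclusion hUV = f := ⟨fun h => Eval.map_unique (y := .tuple j a) hg₁ h, fun h => h ▸ hg₁⟩
  rw [Finset.sum_filter, Finset.sum_eq_single g₀]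
  · simp only [hiff, hg₀, if_true]
  · intro g _ hg
    simp only [if_neg fun hg' : Eval g y (t 0) => hg (hg'.map_unique hg₀), ite_self]
  · simp

omit [Finite (Σ n, L.Relations n)] in
theorem exists_range_eq {V : Set X} (hV : V.Nonempty) (hk : V.ncard ≤ k) :
    ∃ (j : Fin k) (a : Fin (j + 1) → X), Set.range a = V := by
  have hpos : 0 < V.ncard := (Set.ncard_pos).2 hV
  have hcard : Nat.card V = V.ncard - 1 + 1 := by
    rw [Nat.sub_add_cancel hpos]
    rfl
  let e := Finite.equivFinOfCardEq hcard
  -- The index is one less than the length of the tuple.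
  refine ⟨⟨V.ncard - 1, by omega⟩, fun i => (e.symm i : X), ?_⟩
  ext v
  refine ⟨?_, fun hv => ⟨e ⟨v, hv⟩, by simp⟩⟩
  rintro ⟨i, rfl⟩
  exact (e.symm i).2

theorem feasible_of_fracHomomorphic (h : FracHomomorphic (star k X) (star k A)) :
    SAFeasible k X A := by
  obtain ⟨μ, ν, h⟩ := h
  -- Each relevant set gets one arbitrary enumeration as a tuple; `evalWeight_marginal` holds for
  -- all enumerations, so the choices need not be compatible.
  have hp : ∀ V : Set X, ∃ pV : (V → A) → ℚ, V.Nonempty → V.ncard ≤ k →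
      ∃ (j : Fin k) (a : Fin (j + 1) → X), Set.range a = V ∧
        pV = fun f => evalWeight μ (StarCarrier.tuple j a) f := by
    intro V
    by_cases hV : V.Nonempty ∧ V.ncard ≤ k
    · obtain ⟨j, a, ha⟩ := exists_range_eq hV.1 hV.2
      exact ⟨_, fun _ _ => ⟨j, a, ha, rfl⟩⟩
    · exact ⟨fun _ => 0, fun h₁ h₂ => absurd ⟨h₁, h₂⟩ hV⟩
  choose p hp using hp
  refine ⟨p, fun c f => evalWeight μ (StarCarrier.constraint c) f, ?_⟩
  constructor
  · intro V hV hVk f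
    obtain ⟨j, a, ha, hpV⟩ := hp V hV hVk
    rw [hpV]
    exact ⟨h.evalWeight_nonneg _ f, h.evalWeight_le_one (y := StarCarrier.tuple j a) ha f⟩
  · exact fun c f => ⟨h.evalWeight_nonneg _ f, h.evalWeight_le_one (y := StarCarrier.constraint c) rfl f⟩
  · intro V hV hVk
    obtain ⟨j, a, ha, hpV⟩ := hp V hV hVk
    rw [hpV]
    exact h.sum_evalWeight (y := StarCarrier.tuple j a) ha
  · intro U V hUV hU hVk f
    obtain ⟨j, a, ha, hpV⟩ := hp V (hU.mono hUV) hVk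
    obtain ⟨j', a', ha', hpU⟩ := hp U hU ((Set.ncard_le_ncard hUV).trans hVk)
    rw [hpV, hpU]
    exact h.evalWeight_marginal (y := StarCarrier.tuple j a) ha' ha hUV f
  · intro c U hUc hU hUk f
    obtain ⟨j, a, ha, hpU⟩ := hp U hU hUk
    rw [hpU]
    exact h.evalWeight_marginal (y := StarCarrier.constraint c) ha rfl hUc f
  · intro c f hf
    refine Finset.sum_eq_zero fun z _ => if_neg fun hz => hf ?_
    generalize hy : (StarCarrier.constraint c : StarCarrier k X) = y at hz
    cases hz with
    | tuple => cases hy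
    | constraint c' hc hf' =>
      obtain rfl := StarCarrier.constraint.inj hy
      exact hf'

end FracHom

end Star

end SheraliAdams

/-- `L` is a signature: finitely many relation symbols, all of positive arity, and no function
symbols. -/
theorem theorem7p5 (L : FirstOrder.Language.{v, w}) [L.IsRelational] [Finite (Σ n, L.Relations n)]
    [IsEmpty (L.Relations 0)] (k : ℕ) (hk : 1 ≤ k) (X A : SheraliAdams.FinStruct.{u} L) :
    List.TFAE [
      SheraliAdams.SAFeasible k X A,
      ∃ (n : ℕ) (Y : Fin (n + 1) → SheraliAdams.FinStruct.{max u w} (SheraliAdams.starLang L k)),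
        Y 0 = SheraliAdams.star k X ∧ Y (Fin.last n) = SheraliAdams.star k A ∧
        ∀ i : Fin n, SheraliAdams.Homomorphic (Y i.castSucc) (Y i.succ) ∨
          SheraliAdams.EquivOne (Y i.castSucc) (Y i.succ),
      ∃ Y₁ Y₂ : SheraliAdams.FinStruct.{max u w} (SheraliAdams.starLang L k),
        SheraliAdams.Homomorphic (SheraliAdams.star k X) Y₁ ∧ SheraliAdams.EquivOne Y₁ Y₂ ∧
        SheraliAdams.Homomorphic Y₂ (SheraliAdams.star k A)] := by
  tfae_have 1 → 3 := SheraliAdams.exists_equivOne_of_feasible hk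
  tfae_have 3 → 2 := by
    rintro ⟨Y₁, Y₂, h₁, h₂, h₃⟩
    refine ⟨3, ![SheraliAdams.star k X, Y₁, Y₂, SheraliAdams.star k A], rfl, rfl, fun i => ?_⟩
    fin_cases i
    · exact Or.inl h₁
    · exact Or.inr h₂
    · exact Or.inl h₃
  tfae_have 2 → 1 := by
    rintro ⟨n, Y, h₀, hn, h⟩
    refine SheraliAdams.feasible_of_fracHomomorphic (h₀ ▸ ?_)
    -- The target stays fixed while the source moves backwards along the chain.
    refine Fin.reverseInduction (motive := fun i =>
      SheraliAdams.FracHomomorphic (Y i) (SheraliAdams.star k A)) ?_ (fun i hi => ?_) 0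
    · exact hn ▸ SheraliAdams.FracHomomorphic.refl _
    · exact (h i).elim hi.comp_hom hi.comp_equivOne
  tfae_finish
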